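/- Let $p$ be a prime number and let $\mathbb F$ be an algebraic closure of the prime field $\mathbb F_p$. Let $H=\mathbb F((t^{\mathbb Q}))$ be the field of Hahn series, that is, of generalized power series $\sum_{q\in\mathbb Q}a_qt^q$ with coefficients in $\mathbb F$ and well-ordered support, and let $K=\bigcup_{N\ge1}\mathbb F((t^{1/N}))\subset H$ be the subfield of Newton--Puiseux series. For every integer $n\ge0$ let $$s_n=\sum_{j\ge n}\binom{j}{n}\,t^{-1/p^{j+1}}\in H .$$ Then the Hahn series $$s=\sum_{n\ge0}t^n s_n\in H$$ is transcendental over $K$. -/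

import Mathlib

noncomputable section

namespace PuiseuxHahn

/-- The order embedding `ℤ → ℚ`, `k ↦ k / N`, for a positive integer `N`. -/
def divEmb (N : ℕ+) : ℤ ↪o ℚ :=
  OrderEmbedding.ofStrictMono (fun k : ℤ => (k : ℚ) / (N : ℕ)) (fun a b h => by
    have hN : (0 : ℚ) < ((N : ℕ) : ℚ) := by exact_mod_cast N.pos
    have hab : (a : ℚ) < (b : ℚ) := by exact_mod_cast h
    exact div_lt_div_of_pos_right hab hN)

@[simp] theorem divEmb_apply (N : ℕ+) (k : ℤ) : divEmb N k = (k : ℚ) / (N : ℕ) := rfl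

/-- The substitution `t ↦ t ^ (1 / N)`, a ring homomorphism `F((t)) → F((t ^ ℚ))`. -/
def rootEmb (F : Type*) [Field F] (N : ℕ+) : HahnSeries ℤ F →+* HahnSeries ℚ F :=
  HahnSeries.embDomainRingHom
    { toFun := fun k : ℤ => (k : ℚ) / (N : ℕ)
      map_zero' := by simp
      map_add' := fun a b => by push_cast; ring }
    (divEmb N).injective
    (fun a b => (divEmb N).le_iff_le)

theorem mem_range_rootEmb {F : Type*} [Field F] {N : ℕ+} {f : HahnSeries ℚ F} :
    f ∈ (rootEmb F N).fieldRange ↔ ∀ q ∈ f.support, ∃ k : ℤ, q = (k : ℚ) / (N : ℕ) := by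
  constructor
  · rintro ⟨g, rfl⟩ q hq
    by_contra hne
    apply hq
    apply HahnSeries.embDomain_of_notMem_range
    rintro ⟨k, hk⟩
    exact hne ⟨k, hk.symm⟩
  · intro h
    refine ⟨⟨fun k => f.coeff ((k : ℚ) / (N : ℕ)), ?_⟩, ?_⟩
    · rw [Set.isPWO_iff_isWF]
      have hf : f.support.IsWF := f.isWF_support
      rw [Set.isWF_iff_no_descending_seq] at hf ⊢
      intro u hu hmem
      exact hf (fun i => divEmb N (u i)) (fun a b hab => (divEmb N).strictMono (hu hab))
        (fun i => hmem i)
    · ext q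
      by_cases hq : ∃ k : ℤ, q = (k : ℚ) / (N : ℕ)
      · obtain ⟨k, rfl⟩ := hq
        exact HahnSeries.embDomain_coeff (f := divEmb N) (a := k)
      · have h0 : f.coeff q = 0 := by
          by_contra hne
          exact hq (h q hne)
        rw [h0]
        apply HahnSeries.embDomain_of_notMem_range
        rintro ⟨k, hk⟩
        exact hq ⟨k, hk.symm⟩

theorem range_rootEmb_mono (F : Type*) [Field F] (N M : ℕ+) :
    (rootEmb F N).fieldRange ≤ (rootEmb F (N * M)).fieldRange := by
  intro f hf
  rw [mem_range_rootEmb] at hf ⊢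
  intro q hq
  obtain ⟨k, rfl⟩ := hf q hq
  refine ⟨k * (M : ℕ), ?_⟩
  have hN : ((N : ℕ) : ℚ) ≠ 0 := by exact_mod_cast N.ne_zero
  have hM : ((M : ℕ) : ℚ) ≠ 0 := by exact_mod_cast M.ne_zero
  push_cast
  field_simp

theorem exists_common (F : Type*) [Field F] {f g : HahnSeries ℚ F}
    (hf : f ∈ ⋃ N : ℕ+, ((rootEmb F N).fieldRange : Set (HahnSeries ℚ F)))
    (hg : g ∈ ⋃ N : ℕ+, ((rootEmb F N).fieldRange : Set (HahnSeries ℚ F))) :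
    ∃ N : ℕ+, f ∈ (rootEmb F N).fieldRange ∧ g ∈ (rootEmb F N).fieldRange := by
  obtain ⟨N, hN⟩ := Set.mem_iUnion.1 hf
  obtain ⟨M, hM⟩ := Set.mem_iUnion.1 hg
  refine ⟨N * M, range_rootEmb_mono F N M hN, ?_⟩
  rw [mul_comm]
  exact range_rootEmb_mono F M N hM

/-- The field of Newton-Puiseux series `K = ⋃_{N ≥ 1} F((t ^ (1 / N)))` inside `F((t ^ ℚ))`. -/
def puiseuxField (F : Type*) [Field F] : Subfield (HahnSeries ℚ F) where
  carrier := ⋃ N : ℕ+, ((rootEmb F N).fieldRange : Set (HahnSeries ℚ F))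
  mul_mem' := fun {_ _} hf hg => by
    obtain ⟨N, h1, h2⟩ := exists_common F hf hg
    exact Set.mem_iUnion.2 ⟨N, mul_mem h1 h2⟩
  one_mem' := Set.mem_iUnion.2 ⟨1, one_mem _⟩
  add_mem' := fun {_ _} hf hg => by
    obtain ⟨N, h1, h2⟩ := exists_common F hf hg
    exact Set.mem_iUnion.2 ⟨N, add_mem h1 h2⟩
  zero_mem' := Set.mem_iUnion.2 ⟨1, zero_mem _⟩
  neg_mem' := fun {_} hf => by
    obtain ⟨N, h⟩ := Set.mem_iUnion.1 hf
    exact Set.mem_iUnion.2 ⟨N, neg_mem h⟩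
  inv_mem' := fun _ hf => by
    obtain ⟨N, h⟩ := Set.mem_iUnion.1 hf
    exact Set.mem_iUnion.2 ⟨N, inv_mem h⟩

/-- A Hahn series is a Puiseux series iff the exponents in its support have a common
denominator. -/
theorem mem_puiseuxField_iff {F : Type*} [Field F] {f : HahnSeries ℚ F} :
    f ∈ puiseuxField F ↔
      ∃ N : ℕ+, ∀ q ∈ f.support, ∃ k : ℤ, q = (k : ℚ) / (N : ℕ) := by
  have h : f ∈ puiseuxField F ↔
      f ∈ ⋃ N : ℕ+, ((rootEmb F N).fieldRange : Set (HahnSeries ℚ F)) := Iff.rfl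
  rw [h, Set.mem_iUnion]
  exact exists_congr fun N => mem_range_rootEmb

theorem one_div_pow_bounds (p : ℕ) [Fact p.Prime] (j : ℕ) :
    (0 : ℚ) < 1 / (p : ℚ) ^ (j + 1) ∧ 1 / (p : ℚ) ^ (j + 1) < 1 := by
  have hp : (1 : ℚ) < p := by exact_mod_cast (Fact.out : p.Prime).one_lt
  have h1 : (1 : ℚ) < (p : ℚ) ^ (j + 1) := one_lt_pow₀ hp (Nat.succ_ne_zero j)
  exact ⟨by positivity, by rw [div_lt_one (by positivity)]; exact h1⟩

theorem exponent_strictMono (p : ℕ) [Fact p.Prime] :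
    StrictMono (fun x : ℕ ×ₗ ℕ =>
      ((ofLex x).1 : ℚ) - 1 / (p : ℚ) ^ ((ofLex x).2 + 1)) := by
  have hp : (1 : ℚ) < p := by exact_mod_cast (Fact.out : p.Prime).one_lt
  intro x y hxy
  have hx := one_div_pow_bounds p (ofLex x).2
  have hy := one_div_pow_bounds p (ofLex y).2
  rcases (Prod.Lex.lt_iff).1 hxy with h | ⟨h, h'⟩
  · have : ((ofLex x).1 : ℚ) + 1 ≤ ((ofLex y).1 : ℚ) := by exact_mod_cast h
    dsimp only
    linarith [hx.1, hy.2]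
  · have hlt : (p : ℚ) ^ ((ofLex x).2 + 1) < (p : ℚ) ^ ((ofLex y).2 + 1) :=
      pow_lt_pow_right₀ hp (by omega)
    have := one_div_lt_one_div_of_lt (by positivity) hlt
    dsimp only
    rw [h]
    linarith

theorem isPWO_exponents (p : ℕ) [Fact p.Prime] :
    (Set.range (fun x : ℕ ×ₗ ℕ =>
      ((ofLex x).1 : ℚ) - 1 / (p : ℚ) ^ ((ofLex x).2 + 1))).IsPWO := by
  rw [← Set.image_univ]
  exact (Set.isPWO_of_wellQuasiOrderedLE _).image_of_monotone (exponent_strictMono p).monotone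

/-- The summable family `j ↦ (j choose n) t ^ (-1 / p ^ (j + 1))`, `j ≥ 0`; its terms with
`j < n` vanish. -/
def towerFamily (p : ℕ) [Fact p.Prime] (F : Type*) [Field F] (n : ℕ) :
    HahnSeries.SummableFamily ℚ F ℕ where
  toFun j := HahnSeries.single (-1 / (p : ℚ) ^ (j + 1)) ((j.choose n : ℕ) : F)
  isPWO_iUnion_support' := by
    refine (isPWO_exponents p).mono ?_
    intro q hq
    obtain ⟨j, hj⟩ := Set.mem_iUnion.1 hq
    have h := HahnSeries.support_single_subset hj
    rw [Set.mem_singleton_iff] at h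
    exact ⟨toLex (0, j), by rw [h]; simp [neg_div]⟩
  finite_co_support' q := by
    refine Set.Subsingleton.finite ?_
    intro i hi j hj
    have h1 := Set.mem_singleton_iff.1 (HahnSeries.support_single_subset hi)
    have h2 := Set.mem_singleton_iff.1 (HahnSeries.support_single_subset hj)
    have h3 := (exponent_strictMono p).injective (a₁ := toLex (0, i)) (a₂ := toLex (0, j))
      (by have := h1.symm.trans h2; simpa [neg_div] using this)
    simpa using h3

/-- `s_n = ∑_{j ≥ n} (j choose n) t ^ (-1 / p ^ (j + 1))`. -/
def towerSeries (p : ℕ) [Fact p.Prime] (F : Type*) [Field F] (n : ℕ) : HahnSeries ℚ F :=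
  (towerFamily p F n).hsum

theorem support_shift_subset (p : ℕ) [Fact p.Prime] (F : Type*) [Field F] (n : ℕ) {q : ℚ}
    (hq : q ∈ (HahnSeries.single (n : ℚ) (1 : F) * towerSeries p F n).support) :
    ∃ j : ℕ, q = (n : ℚ) - 1 / (p : ℚ) ^ (j + 1) := by
  obtain ⟨a, ha, b, hb, rfl⟩ := Set.mem_add.1 (HahnSeries.support_mul_subset hq)
  have h1 := Set.mem_singleton_iff.1 (HahnSeries.support_single_subset ha)
  obtain ⟨j, hj⟩ := Set.mem_iUnion.1 (HahnSeries.SummableFamily.support_hsum_subset hb)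
  have h2 := Set.mem_singleton_iff.1 (HahnSeries.support_single_subset hj)
  exact ⟨j, by rw [h1, h2]; ring⟩

/-- The summable family `n ↦ t ^ n * s_n`, `n ≥ 0`. -/
def shiftedFamily (p : ℕ) [Fact p.Prime] (F : Type*) [Field F] :
    HahnSeries.SummableFamily ℚ F ℕ where
  toFun n := HahnSeries.single (n : ℚ) (1 : F) * towerSeries p F n
  isPWO_iUnion_support' := by
    refine (isPWO_exponents p).mono ?_
    intro q hq
    obtain ⟨n, hn⟩ := Set.mem_iUnion.1 hq
    obtain ⟨j, rfl⟩ := support_shift_subset p F n hn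
    exact ⟨toLex (n, j), rfl⟩
  finite_co_support' q := by
    refine Set.Subsingleton.finite ?_
    intro n hn m hm
    obtain ⟨i, hi⟩ := support_shift_subset p F n hn
    obtain ⟨j, hj⟩ := support_shift_subset p F m hm
    have h3 := (exponent_strictMono p).injective (a₁ := toLex (n, i)) (a₂ := toLex (m, j))
      (hi.symm.trans hj)
    have h4 : (n, i) = (m, j) := toLex.injective h3
    exact (Prod.mk.inj h4).1

/-- `s = ∑_{n ≥ 0} t ^ n s_n`. -/
def sSeries (p : ℕ) [Fact p.Prime] (F : Type*) [Field F] : HahnSeries ℚ F :=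
  (shiftedFamily p F).hsum

end PuiseuxHahn

end

namespace PuiseuxHahn

/-! Summing over `n` first gives `s = ∑_j (1 + t) ^ j * t ^ (-1 / p ^ (j + 1))`. Frobenius and the
shift `j ↦ i + j` turn the summands of `s ^ (p ^ i)` into `(1 + t ^ (p ^ i)) ^ (i + j) * t ^ (-1 / p
^ (j + 1))`. Suppose `∑ a_i * s ^ (p ^ i) = 0`, where all `a_i` have exponents in `(1 / N) ℤ`. If `p
^ (j + 1) ∤ N`, only these summands meet the coset of `-1 / p ^ (j + 1)`, so `∑ a_i * (1 + t ^ (p ^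
i)) ^ (i + j) = 0` (`sum_mul_eq_zero_of_coset`). Letting `j` vary gives a Vandermonde system with
distinct nodes `1 + t ^ (p ^ i)`, so every `a_i` vanishes. The powers of an algebraic element span a
finite-dimensional space, so `s` is transcendental. -/

/-! ### Supports of Frobenius powers and restriction to cosets. -/

theorem support_pow_succ_lt {R : Type*} [CommRing R] {f : HahnSeries ℚ R} {h : ℚ}
    (hf : ∀ q ∈ f.support, q < h) (n : ℕ) :
    ∀ q ∈ (f ^ (n + 1)).support, q < ((n + 1 : ℕ) : ℚ) * h := by
  induction n with
  | zero => simpa using hf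
  | succ n ih =>
    intro q hq
    rw [pow_succ] at hq
    obtain ⟨a, ha, b, hb, rfl⟩ := Set.mem_add.1 (HahnSeries.support_mul_subset hq)
    have h1 := ih a ha
    have h2 := hf b hb
    push_cast at h1 ⊢
    linarith

theorem support_pow_succ_gt {R : Type*} [CommRing R] {f : HahnSeries ℚ R} {h : ℚ}
    (hf : ∀ q ∈ f.support, h < q) (n : ℕ) :
    ∀ q ∈ (f ^ (n + 1)).support, ((n + 1 : ℕ) : ℚ) * h < q := by
  induction n with
  | zero => simpa using hf
  | succ n ih =>
    intro q hq
    rw [pow_succ] at hq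
    obtain ⟨a, ha, b, hb, rfl⟩ := Set.mem_add.1 (HahnSeries.support_mul_subset hq)
    have h1 := ih a ha
    have h2 := hf b hb
    push_cast at h1 ⊢
    linarith

/-- In characteristic `p`, the exponents of `f ^ (p ^ i)` are `p ^ i` times exponents of `f`. -/
theorem mem_support_of_mem_support_pow_char_pow (p : ℕ) [Fact p.Prime] {R : Type*} [CommRing R]
    [CharP (HahnSeries ℚ R) p] {f : HahnSeries ℚ R} (i : ℕ) {q : ℚ}
    (hq : q ∈ (f ^ p ^ i).support) : q / (p : ℚ) ^ i ∈ f.support := by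
  by_contra hf
  obtain ⟨n, hn⟩ : ∃ n, p ^ i = n + 1 :=
    Nat.exists_eq_succ_of_ne_zero (pow_ne_zero _ (Fact.out : p.Prime).ne_zero)
  have hp : (p : ℚ) ^ i = ((n + 1 : ℕ) : ℚ) := by rw [← hn]; push_cast; rfl
  have hpos : ((n + 1 : ℕ) : ℚ) ≠ 0 := by positivity
  set h := q / (p : ℚ) ^ i with hh
  have hqh : q = ((n + 1 : ℕ) : ℚ) * h := by rw [hh, hp]; field_simp
  have hlow : ∀ a ∈ (HahnSeries.truncLT h f).support, a < h := fun a ha => by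
    rw [HahnSeries.support_truncLT] at ha
    exact ha.2
  have hhigh : ∀ a ∈ (f - HahnSeries.truncLT h f).support, h < a := fun a ha => by
    rw [HahnSeries.mem_support, HahnSeries.coeff_sub, HahnSeries.coeff_truncLT] at ha
    by_contra hle
    rcases (not_lt.1 hle).lt_or_eq with hlt | rfl
    · simp [hlt] at ha
    · exact hf (by simpa using ha)
  -- As `h` is not an exponent of `f`, the series splits into parts strictly below and above `h`.
  -- Frobenius is additive, and the powers of the two parts both miss `p ^ i * h`.
  rw [← add_sub_cancel (HahnSeries.truncLT h f) f, add_pow_char_pow, hn] at hq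
  rcases HahnSeries.support_add_subset _ _ hq with h1 | h1
  · exact (support_pow_succ_lt hlow n q h1).ne hqh
  · exact (support_pow_succ_gt hhigh n q h1).ne' hqh

/-- Over coefficients supported in a subgroup `A`, a linear relation may be restricted to a single
coset of `A`. -/
theorem sum_mul_eq_zero_of_coset {R ι : Type*} [CommRing R] [Fintype ι] (A : AddSubgroup ℚ) (r : ℚ)
    (a P Q : ι → HahnSeries ℚ R) (ha : ∀ i, ∀ q ∈ (a i).support, q ∈ A)
    (hP : ∀ i, ∀ q ∈ (P i).support, q - r ∈ A) (hQ : ∀ i, ∀ q ∈ (Q i).support, q - r ∉ A)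
    (h : ∑ i, a i * (P i + Q i) = 0) : ∑ i, a i * P i = 0 := by
  ext q
  by_cases hq : q - r ∈ A
  · have hz : ∀ i, (a i * Q i).coeff q = 0 := fun i => by
      by_contra hne
      obtain ⟨x, hx, y, hy, rfl⟩ :=
        Set.mem_add.1 (HahnSeries.support_mul_subset (HahnSeries.mem_support _ _ |>.2 hne))
      refine hQ i y hy ?_
      have := A.sub_mem hq (ha i x hx)
      rwa [show x + y - r - x = y - r by ring] at this
    have := congrArg (fun f => HahnSeries.coeff f q) h
    simpa [mul_add, HahnSeries.coeff_sum, hz] using this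
  · rw [HahnSeries.coeff_sum, HahnSeries.coeff_zero]
    refine Finset.sum_eq_zero fun i _ => ?_
    by_contra hne
    obtain ⟨x, hx, y, hy, rfl⟩ :=
      Set.mem_add.1 (HahnSeries.support_mul_subset (HahnSeries.mem_support _ _ |>.2 hne))
    refine hq ?_
    have := A.add_mem (ha i x hx) (hP i y hy)
    rwa [show x + (y - r) = x + y - r by ring] at this

/-! ### Coefficients of `s` and its pieces modulo `ℤ`. -/

theorem towerSeries_coeff (p : ℕ) [Fact p.Prime] (F : Type*) [Field F] (n : ℕ) (q : ℚ) :
    (towerSeries p F n).coeff q =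
      ∑ᶠ j : ℕ, (HahnSeries.single (-1 / (p : ℚ) ^ (j + 1)) ((j.choose n : ℕ) : F)).coeff q :=
  HahnSeries.SummableFamily.coeff_hsum

theorem exponent_inj (p : ℕ) [Fact p.Prime] {n j n' j' : ℕ}
    (h : (n : ℚ) - 1 / (p : ℚ) ^ (j + 1) = (n' : ℚ) - 1 / (p : ℚ) ^ (j' + 1)) :
    n = n' ∧ j = j' := by
  have h3 := (exponent_strictMono p).injective (a₁ := toLex (n, j)) (a₂ := toLex (n', j')) h
  exact Prod.mk.inj (toLex.injective h3)

theorem sSeries_coeff_exponent (p : ℕ) [Fact p.Prime] (F : Type*) [Field F] (n j : ℕ) :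
    (sSeries p F).coeff ((n : ℚ) - 1 / (p : ℚ) ^ (j + 1)) = (j.choose n : F) := by
  have h1 : (sSeries p F).coeff ((n : ℚ) - 1 / (p : ℚ) ^ (j + 1)) =
      ∑ᶠ m : ℕ, (HahnSeries.single (m : ℚ) (1 : F) * towerSeries p F m).coeff
        ((n : ℚ) - 1 / (p : ℚ) ^ (j + 1)) := HahnSeries.SummableFamily.coeff_hsum
  rw [h1, finsum_eq_single _ n, HahnSeries.coeff_single_mul, one_mul, towerSeries_coeff,
    finsum_eq_single _ j]
  · rw [show (n : ℚ) - 1 / (p : ℚ) ^ (j + 1) - n = -1 / (p : ℚ) ^ (j + 1) by ring,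
      HahnSeries.coeff_single_same]
  · intro k hk
    refine HahnSeries.coeff_single_of_ne fun h => hk ?_
    refine (exponent_inj p (n := n) (n' := n) ?_).2.symm
    linear_combination h
  · intro m hm
    by_contra hne
    obtain ⟨k, hk⟩ := support_shift_subset p F m hne
    exact hm (exponent_inj p hk).1.symm

theorem exists_of_mem_support_sSeries (p : ℕ) [Fact p.Prime] (F : Type*) [Field F] {q : ℚ}
    (hq : q ∈ (sSeries p F).support) : ∃ n j : ℕ, q = (n : ℚ) - 1 / (p : ℚ) ^ (j + 1) := by
  obtain ⟨n, hn⟩ := Set.mem_iUnion.1 (HahnSeries.SummableFamily.support_hsum_subset hq)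
  exact ⟨n, support_shift_subset p F n hn⟩

/-- The part `(1 + t) ^ j * t ^ (-1 / p ^ (j + 1))` of `s` whose exponents are congruent to
`-1 / p ^ (j + 1)` modulo `ℤ`. -/
noncomputable def cosetPart (p : ℕ) (F : Type*) [Field F] (j : ℕ) : HahnSeries ℚ F :=
  (1 + HahnSeries.single 1 1) ^ j * HahnSeries.single (-1 / (p : ℚ) ^ (j + 1)) 1

theorem cosetPart_eq_sum (p : ℕ) (F : Type*) [Field F] (j : ℕ) :
    cosetPart p F j = ∑ n ∈ Finset.range (j + 1),
      HahnSeries.single ((n : ℚ) - 1 / (p : ℚ) ^ (j + 1)) (j.choose n : F) := by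
  rw [cosetPart, add_comm, add_pow, Finset.sum_mul]
  refine Finset.sum_congr rfl fun n _ => ?_
  rw [one_pow, mul_one, HahnSeries.single_pow, one_pow, mul_right_comm,
    HahnSeries.single_mul_single, ← nsmul_eq_mul', mul_one,
    show (n : ℚ) - 1 / (p : ℚ) ^ (j + 1) = n • (1 : ℚ) + -1 / (p : ℚ) ^ (j + 1) by simp; ring,
    ← nsmul_one (j.choose n)]
  exact (map_nsmul (HahnSeries.single.addMonoidHom _) _ _).symm

theorem exists_of_mem_support_sSeries_sub_cosetPart (p : ℕ) [Fact p.Prime] (F : Type*) [Field F]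
    (j : ℕ) {q : ℚ} (hq : q ∈ (sSeries p F - cosetPart p F j).support) :
    ∃ n k : ℕ, k ≠ j ∧ q = (n : ℚ) - 1 / (p : ℚ) ^ (k + 1) := by
  by_contra! hne
  rw [HahnSeries.mem_support, HahnSeries.coeff_sub, cosetPart_eq_sum, HahnSeries.coeff_sum] at hq
  by_cases hj : ∃ n : ℕ, q = (n : ℚ) - 1 / (p : ℚ) ^ (j + 1)
  · obtain ⟨n, rfl⟩ := hj
    refine hq ?_
    rw [sSeries_coeff_exponent, Finset.sum_eq_single n, HahnSeries.coeff_single_same, sub_self]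
    · intro m _ hm
      exact HahnSeries.coeff_single_of_ne fun h => hm (exponent_inj p h).1.symm
    -- Beyond `n = j` the binomial coefficient vanishes, so the finite sum captures the whole class.
    · intro hn
      rw [HahnSeries.coeff_single_same, Nat.choose_eq_zero_of_lt (by simpa using hn),
        Nat.cast_zero]
  · refine hq ?_
    rw [Finset.sum_eq_zero fun n _ => HahnSeries.coeff_single_of_ne fun h => hj ⟨n, h⟩, sub_zero]
    by_contra hs
    obtain ⟨n, k, rfl⟩ := exists_of_mem_support_sSeries p F hs
    by_cases hk : k = j
    · exact hj ⟨n, hk ▸ rfl⟩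
    · exact hne n k hk rfl

/-! ### Separating cosets of `(1 / N) ℤ`. -/

/-- Clearing denominators gives `L * (p ^ (k - j) - 1) = m * p ^ k`, and `p ^ (k - j) - 1` is prime
to `p`. -/
theorem dvd_of_one_div_sub_one_div_eq (p : ℕ) [Fact p.Prime] {j k L : ℕ} {m : ℤ} (hL : L ≠ 0)
    (hjk : j < k) (h : 1 / (p : ℚ) ^ j - 1 / (p : ℚ) ^ k = m / L) : p ^ k ∣ L := by
  obtain ⟨d, rfl⟩ := Nat.exists_eq_add_of_lt hjk
  have hp : (p : ℚ) ≠ 0 := by exact_mod_cast (Fact.out : p.Prime).ne_zero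
  have hL' : (L : ℚ) ≠ 0 := by exact_mod_cast hL
  have h1 : (L : ℚ) * ((p : ℚ) ^ (d + 1) - 1) = m * (p : ℚ) ^ (j + d + 1) := by
    field_simp at h
    have hpj : (p : ℚ) ^ j ≠ 0 := pow_ne_zero _ hp
    apply mul_left_cancel₀ hpj
    rw [show j + d + 1 = j + (d + 1) by ring, pow_add] at h ⊢
    linear_combination h
  have h2 : (L : ℤ) * ((p : ℤ) ^ (d + 1) - 1) = m * (p : ℤ) ^ (j + d + 1) := by exact_mod_cast h1
  have hc : IsCoprime ((p : ℤ) ^ (j + d + 1)) ((p : ℤ) ^ (d + 1) - 1) := by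
    refine IsCoprime.pow_left ⟨(p : ℤ) ^ d, -1, by ring⟩
  have h3 : (p : ℤ) ^ (j + d + 1) ∣ L := hc.dvd_of_dvd_mul_right ⟨m, by rw [h2]; ring⟩
  exact_mod_cast h3

theorem pow_dvd_of_one_div_sub_one_div_eq (p : ℕ) [Fact p.Prime] {j k L : ℕ} {m : ℤ} (hL : L ≠ 0)
    (hjk : k ≠ j) (h : 1 / (p : ℚ) ^ j - 1 / (p : ℚ) ^ k = m / L) : p ^ j ∣ L := by
  rcases hjk.lt_or_gt with hlt | hlt
  · refine dvd_of_one_div_sub_one_div_eq p (m := -m) hL hlt ?_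
    push_cast
    linear_combination -h
  · exact (pow_dvd_pow p hlt.le).trans (dvd_of_one_div_sub_one_div_eq p hL hlt h)

/-- The additive group `(1 / N) ℤ`. -/
def divSubgroup (N : ℕ) : AddSubgroup ℚ where
  carrier := {q | ∃ k : ℤ, q = k / N}
  zero_mem' := ⟨0, by simp⟩
  add_mem' := by
    rintro _ _ ⟨a, rfl⟩ ⟨b, rfl⟩
    exact ⟨a + b, by push_cast; ring⟩
  neg_mem' := by
    rintro _ ⟨a, rfl⟩
    exact ⟨-a, by push_cast; ring⟩

theorem mem_divSubgroup {N : ℕ} {q : ℚ} : q ∈ divSubgroup N ↔ ∃ k : ℤ, q = k / N := Iff.rfl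

theorem intCast_mem_divSubgroup {N : ℕ} (hN : N ≠ 0) (m : ℤ) : (m : ℚ) ∈ divSubgroup N :=
  ⟨m * N, by
    have : (N : ℚ) ≠ 0 := by exact_mod_cast hN
    push_cast; field_simp⟩

/-- The index `i + j` makes the monomial factor on the right independent of `i`, so that it cancels
from the relation. -/
theorem cosetPart_pow_char_pow (p : ℕ) [Fact p.Prime] (F : Type*) [Field F]
    [CharP (HahnSeries ℚ F) p] (i j : ℕ) :
    cosetPart p F (i + j) ^ p ^ i =
      (1 + HahnSeries.single ((p : ℚ) ^ i) 1) ^ (i + j) *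
        HahnSeries.single (-1 / (p : ℚ) ^ (j + 1)) 1 := by
  have hp : (p : ℚ) ≠ 0 := by exact_mod_cast (Fact.out : p.Prime).ne_zero
  rw [cosetPart, mul_pow, ← pow_mul, mul_comm (i + j), pow_mul, add_pow_char_pow, one_pow,
    HahnSeries.single_pow, HahnSeries.single_pow, one_pow]
  congr 3
  · simp
  · rw [nsmul_eq_mul]
    push_cast
    rw [show i + j + 1 = i + (j + 1) by ring, pow_add]
    field_simp

theorem sub_mem_of_mem_support_cosetPart_pow (p : ℕ) [Fact p.Prime] (F : Type*) [Field F]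
    [CharP (HahnSeries ℚ F) p] {N : ℕ} (hN : N ≠ 0) (i j : ℕ) {q : ℚ}
    (hq : q ∈ (cosetPart p F (i + j) ^ p ^ i).support) :
    q - -1 / (p : ℚ) ^ (j + 1) ∈ divSubgroup N := by
  have hp : (p : ℚ) ≠ 0 := by exact_mod_cast (Fact.out : p.Prime).ne_zero
  have h := mem_support_of_mem_support_pow_char_pow p i hq
  rw [cosetPart_eq_sum, HahnSeries.mem_support, HahnSeries.coeff_sum] at h
  obtain ⟨n, -, hn⟩ := Finset.exists_ne_zero_of_sum_ne_zero h
  have h2 := Set.mem_singleton_iff.1 (HahnSeries.support_single_subset hn)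
  have h3 : q - -1 / (p : ℚ) ^ (j + 1) = ((p ^ i * n : ℤ) : ℚ) := by
    rw [div_eq_iff (pow_ne_zero _ hp)] at h2
    rw [h2, show i + j + 1 = i + (j + 1) by ring, pow_add]
    push_cast
    field_simp
    ring
  rw [h3]
  exact intCast_mem_divSubgroup hN _

theorem sub_notMem_of_mem_support_sub_cosetPart_pow (p : ℕ) [Fact p.Prime] (F : Type*) [Field F]
    [CharP (HahnSeries ℚ F) p] {N : ℕ} (hN : N ≠ 0) (i j : ℕ) (hj : ¬ p ^ (j + 1) ∣ N) {q : ℚ}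
    (hq : q ∈ ((sSeries p F - cosetPart p F (i + j)) ^ p ^ i).support) :
    q - -1 / (p : ℚ) ^ (j + 1) ∉ divSubgroup N := by
  have hp0 : p ≠ 0 := (Fact.out : p.Prime).ne_zero
  have hp : (p : ℚ) ≠ 0 := by exact_mod_cast hp0
  have hN' : (N : ℚ) ≠ 0 := by exact_mod_cast hN
  obtain ⟨n, k, hk, hn⟩ := exists_of_mem_support_sSeries_sub_cosetPart p F _
    (mem_support_of_mem_support_pow_char_pow p i hq)
  intro hmem
  obtain ⟨m, hm⟩ := mem_divSubgroup.1
    ((divSubgroup N).sub_mem hmem (intCast_mem_divSubgroup hN (p ^ i * n)))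
  -- Once the integer part is removed, `hm` equates `1 / p ^ (j + 1) - p ^ i / p ^ (k + 1)` with `m
  -- / N`; dividing by `p ^ i` gives two distinct inverse powers of `p`.
  have hd : p ^ (i + j + 1) ∣ p ^ i * N := by
    refine pow_dvd_of_one_div_sub_one_div_eq p (m := m) (k := k + 1)
      (mul_ne_zero (pow_ne_zero _ hp0) hN) (by omega) ?_
    rw [div_eq_iff (pow_ne_zero _ hp)] at hn
    rw [hn] at hm
    have h1 : (1 / (p : ℚ) ^ (i + j + 1) - 1 / (p : ℚ) ^ (k + 1)) * (p : ℚ) ^ i = m / N := by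
      rw [← hm, show i + j + 1 = i + (j + 1) by ring, pow_add]
      push_cast
      field_simp
      ring
    rw [← eq_div_iff (pow_ne_zero _ hp)] at h1
    rw [h1, div_div]
    push_cast
    ring
  rw [show i + j + 1 = i + (j + 1) by ring, pow_add] at hd
  exact hj (Nat.dvd_of_mul_dvd_mul_left (pow_pos (Fact.out : p.Prime).pos i) hd)

theorem exists_common_denominator {F ι : Type*} [Field F] [Fintype ι] (a : ι → puiseuxField F) :
    ∃ N : ℕ, N ≠ 0 ∧ ∀ i, ∀ q ∈ (a i : HahnSeries ℚ F).support, q ∈ divSubgroup N := by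
  choose N hN using fun i => mem_puiseuxField_iff.1 (a i).2
  refine ⟨∏ i, (N i : ℕ), Finset.prod_ne_zero_iff.2 fun i _ => (N i).ne_zero, fun i q hq => ?_⟩
  obtain ⟨k, rfl⟩ := hN i q hq
  obtain ⟨c, hc⟩ := Finset.dvd_prod_of_mem (fun i => (N i : ℕ)) (Finset.mem_univ i)
  have h0 : ∏ i, (N i : ℕ) ≠ 0 := Finset.prod_ne_zero_iff.2 fun i _ => (N i).ne_zero
  have hc0 : c ≠ 0 := by
    rintro rfl
    exact h0 (by simpa using hc)
  refine ⟨k * c, ?_⟩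
  have h1 : ((N i : ℕ) : ℚ) ≠ 0 := by exact_mod_cast (N i).ne_zero
  have h2 : (c : ℚ) ≠ 0 := by exact_mod_cast hc0
  rw [hc]
  push_cast
  field_simp

/-! ### Vandermonde argument and transcendence. -/

theorem one_add_single_injective (p : ℕ) [Fact p.Prime] (F : Type*) [Field F] :
    Function.Injective fun i : ℕ => (1 + HahnSeries.single ((p : ℚ) ^ i) 1 : HahnSeries ℚ F) := by
  intro i j h
  by_contra hij
  have h1 : HahnSeries.single ((p : ℚ) ^ i) (1 : F) = HahnSeries.single ((p : ℚ) ^ j) 1 :=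
    add_left_cancel h
  have hp : (1 : ℚ) < p := by exact_mod_cast (Fact.out : p.Prime).one_lt
  have h2 := congrArg (fun f => HahnSeries.coeff f ((p : ℚ) ^ i)) h1
  simp only [HahnSeries.coeff_single_same] at h2
  rw [HahnSeries.coeff_single_of_ne fun he => hij (pow_right_injective₀ (by linarith) hp.ne' he)]
    at h2
  exact one_ne_zero h2

theorem one_add_single_ne_zero (p : ℕ) [Fact p.Prime] (F : Type*) [Field F] (i : ℕ) :
    (1 + HahnSeries.single ((p : ℚ) ^ i) 1 : HahnSeries ℚ F) ≠ 0 := by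
  intro h
  have hp : (p : ℚ) ^ i ≠ 0 :=
    pow_ne_zero _ (by exact_mod_cast (Fact.out : p.Prime).ne_zero)
  have h2 := congrArg (fun f => HahnSeries.coeff f 0) h
  simp [HahnSeries.coeff_single_of_ne hp.symm] at h2

/-- The Frobenius iterates of `s` satisfy no linear relation over the Puiseux series. -/
theorem linearIndependent_sSeries_pow (p : ℕ) [Fact p.Prime] (F : Type*) [Field F] [CharP F p]
    (d : ℕ) : LinearIndependent (puiseuxField F) fun i : Fin d => sSeries p F ^ p ^ (i : ℕ) := by
  have : CharP (HahnSeries ℚ F) p :=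
    charP_of_injective_ringHom (HahnSeries.C_injective (Γ := ℚ) (R := F)) p
  rw [Fintype.linearIndependent_iff]
  intro a ha
  obtain ⟨N, hN, haN⟩ := exists_common_denominator a
  have hrel : ∀ l : ℕ, ∑ i : Fin d, (a i : HahnSeries ℚ F) *
      cosetPart p F (i + (N + l)) ^ p ^ (i : ℕ) = 0 := by
    intro l
    refine sum_mul_eq_zero_of_coset (divSubgroup N) (-1 / (p : ℚ) ^ (N + l + 1)) _ _
      (fun i => (sSeries p F - cosetPart p F (i + (N + l))) ^ p ^ (i : ℕ)) haN
      (fun i q hq => sub_mem_of_mem_support_cosetPart_pow p F hN i (N + l) hq)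
      (fun i q hq => sub_notMem_of_mem_support_sub_cosetPart_pow p F hN i (N + l) ?_ hq) ?_
    -- Starting at level `N` suffices because `p ^ (N + l + 1) > N`.
    · intro hdvd
      have h1 := Nat.le_of_dvd (Nat.pos_of_ne_zero hN) hdvd
      have h2 := Nat.lt_pow_self (n := N + l + 1) (Fact.out : p.Prime).one_lt
      omega
    · rw [← ha]
      refine Finset.sum_congr rfl fun i _ => ?_
      rw [← add_pow_char_pow, add_sub_cancel]
      rfl
  -- The exponent `i + (N + l)` is split: the part `i + N` is absorbed into the unknown, leaving the
  -- `l`-th power of the node.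
  have hv := Matrix.eq_zero_of_forall_pow_sum_mul_pow_eq_zero
    (f := fun i : Fin d => (1 + HahnSeries.single ((p : ℚ) ^ (i : ℕ)) 1 : HahnSeries ℚ F))
    (v := fun i : Fin d => (a i : HahnSeries ℚ F) *
      (1 + HahnSeries.single ((p : ℚ) ^ (i : ℕ)) 1) ^ ((i : ℕ) + N))
    ((one_add_single_injective p F).comp Fin.val_injective) (fun l => by
      have h := hrel l
      simp_rw [cosetPart_pow_char_pow, ← mul_assoc, ← Finset.sum_mul] at h
      have h0 : (HahnSeries.single (-1 / (p : ℚ) ^ (N + (l : ℕ) + 1)) (1 : F)) ≠ 0 :=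
        HahnSeries.single_ne_zero one_ne_zero
      rw [← (mul_eq_zero.1 h).resolve_right h0]
      refine Finset.sum_congr rfl fun i _ => ?_
      rw [mul_assoc, ← pow_add, add_assoc])
  intro i
  have hi := (mul_eq_zero.1 (congrFun hv i)).resolve_right
    (pow_ne_zero _ (one_add_single_ne_zero p F i))
  exact Subtype.ext hi

end PuiseuxHahn

/-- All powers of `x` lie in the finite-dimensional space `K(x)`, so one more of them than its
dimension must be dependent. -/
theorem exists_not_linearIndependent_pow {K L : Type*} [Field K] [Field L] [Algebra K L] {x : L}
    (hx : IsAlgebraic K x) (e : ℕ → ℕ) :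
    ∃ d : ℕ, ¬ LinearIndependent K fun i : Fin d => x ^ e i := by
  have := IntermediateField.adjoin.finiteDimensional hx.isIntegral
  refine ⟨Module.finrank K (IntermediateField.adjoin K {x}) + 1, fun h => ?_⟩
  have h1 : LinearIndependent K
      fun i : Fin (Module.finrank K (IntermediateField.adjoin K {x}) + 1) =>
        (IntermediateField.AdjoinSimple.gen K x) ^ e i := by
    refine LinearIndependent.of_comp (IntermediateField.val _).toLinearMap ?_
    convert h using 1
    ext i
    simp
  have h2 := h1.fintype_card_le_finrank
  simp at h2

theorem mainTheorem3 (p : ℕ) [Fact p.Prime] (F : Type*) [Field F] [Algebra (ZMod p) F]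
    [IsAlgClosure (ZMod p) F] :
    Transcendental (PuiseuxHahn.puiseuxField F) (PuiseuxHahn.sSeries p F) := by
  have : CharP F p := charP_of_injective_algebraMap (algebraMap (ZMod p) F).injective p
  intro hs
  obtain ⟨d, hd⟩ := exists_not_linearIndependent_pow hs (p ^ ·)
  exact hd (PuiseuxHahn.linearIndependent_sSeries_pow p F d)
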